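/- Let $(M,g)$ be a (smooth, finite-dimensional) semi-Riemannian manifold, let $\epsilon\in\{1,-1\}$, and let $(\widehat M,\widehat g)=(\mathbb{R}_{>0}\times M,\ \epsilon\,\mathrm{d}r^2+r^2g)$ be the cone over $(M,g)$. Let $V$ be a smooth vector field on $\widehat M$ that is parallel for the Levi-Civita connection of $\widehat g$ and light-like, i.e. $V\neq 0$ and $\widehat g(V,V)=0$ at every point. Then the function $u=\widehat g(V,\partial_r)$ does not depend on $r$, hence is a smooth function on $M$, and, with $\nabla u$ denoting the gradient of $u$ with respect to $g$, the following hold. 1. Let $J\subset\mathbb{R}$ be an open interval containing $0$, and let $\gamma:J\to M$ be a geodesic of $(M,g)$ with $g(\gamma'(0),\gamma'(0))=-\epsilon$. Then $f=u\circ\gamma$ is smooth and satisfies $f''=f$ on $J$, and for all $t\in J$ $$f(t)=u(\gamma(0))\cosh t+g\bigl(\nabla u|_{\gamma(0)},\gamma'(0)\bigr)\sinh t .$$ 2. If $(M,g)$ is geodesically complete, then the image of $u$ contains $(0,\infty)$ whenever $u$ takes a positive value, and it contains $(-\infty,0)$ whenever $u$ takes a negative value. -/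

import Mathlib

open Set Filter
open scoped Manifold ContDiff Topology

noncomputable section

section SemiRiemannian

variable {E : Type*} [NormedAddCommGroup E] [NormedSpace ℝ E]
  {H : Type*} [TopologicalSpace H] (I : ModelWithCorners ℝ E H)
  (M : Type*) [TopologicalSpace M] [ChartedSpace H M] [IsManifold I ∞ M]

/-- A semi-Riemannian metric on `M`: a smooth section of the bundle of bilinear forms on the
tangent spaces which is symmetric and nondegenerate at every point. -/
structure SemiRiemannianMetric where
  /-- The bilinear form on the tangent space at `p`. -/
  form (p : M) : TangentSpace I p →L[ℝ] TangentSpace I p →L[ℝ] ℝ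
  symm (p : M) (v w : TangentSpace I p) : form p v w = form p w v
  nondegenerate (p : M) (v : TangentSpace I p) (hv : ∀ w, form p v w = 0) : v = 0
  contMDiff : ContMDiff I (I.prod 𝓘(ℝ, E →L[ℝ] E →L[ℝ] ℝ)) ∞
    (fun p ↦ Bundle.TotalSpace.mk' (E →L[ℝ] E →L[ℝ] ℝ)
      (E := fun p ↦ TangentSpace I p →L[ℝ] TangentSpace I p →L[ℝ] ℝ) p (form p))

variable {I M}

/-- The vector of `T_q M` whose components in the chart centred at `p` are given by an element of
`E` (the inverse of the differential of the chart), as a linear map. -/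
def ofChart (I : ModelWithCorners ℝ E H) [IsManifold I ∞ M] (p q : M) :
    E →L[ℝ] TangentSpace I q :=
  (trivializationAt E (TangentSpace I) p).symmL ℝ q

/-- The components in the chart centred at `p` of tangent vectors at `q`
(the differential of the chart). -/
def toChart (I : ModelWithCorners ℝ E H) [IsManifold I ∞ M] (p q : M) :
    TangentSpace I q →L[ℝ] E :=
  (trivializationAt E (TangentSpace I) p).continuousLinearMapAt ℝ q

/-- The bilinear form `(v, w) ↦ B(A v, A w)`. -/
def pullbackForm {F F' : Type*} [AddCommGroup F] [Module ℝ F] [TopologicalSpace F]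
    [IsTopologicalAddGroup F] [ContinuousSMul ℝ F]
    [AddCommGroup F'] [Module ℝ F'] [TopologicalSpace F']
    [IsTopologicalAddGroup F'] [ContinuousSMul ℝ F']
    (B : F →L[ℝ] F →L[ℝ] ℝ) (A : F' →L[ℝ] F) : F' →L[ℝ] F' →L[ℝ] ℝ :=
  (ContinuousLinearMap.precomp ℝ A).comp (B.comp A)

/-- The Christoffel symbols of the first kind of a metric `G` on an open set of `E`, at `x`:
`c ↦ ½ (∂_a G(b, c) + ∂_b G(a, c) - ∂_c G(a, b))` for constant vectors `a`, `b`, `c`. -/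
def christoffelFirst (G : E → E →L[ℝ] E →L[ℝ] ℝ) (x a b : E) : E →L[ℝ] ℝ :=
  (1 / 2 : ℝ) • (fderiv ℝ G x a b + fderiv ℝ G x b a - ((fderiv ℝ G x).flip a).flip b)

/-- The velocity `γ'(t)` of a curve in `M`. -/
def velocity (I : ModelWithCorners ℝ E H) (γ : ℝ → M) (t : ℝ) : TangentSpace I (γ t) :=
  mfderiv 𝓘(ℝ, ℝ) I γ t (1 : ℝ)

namespace SemiRiemannianMetric

variable (g : SemiRiemannianMetric I M)

/-- The metric in the chart centred at `p`: the components `g_{ij}(x)`, written invariantly as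
a bilinear form on `E` that depends on the point `x` of the chart domain in `E`. -/
def inChart (p : M) (x : E) : E →L[ℝ] E →L[ℝ] ℝ :=
  pullbackForm (g.form ((extChartAt I p).symm x)) (ofChart I p ((extChartAt I p).symm x))

/-- The Christoffel symbols of the first kind at `p`, in the chart centred at `p`. -/
def christoffel (p : M) (a b : E) : E →L[ℝ] ℝ :=
  christoffelFirst (g.inChart p) (extChartAt I p p) a b

variable [FiniteDimensional ℝ E]

theorem exists_sharp (p : M) (l : TangentSpace I p →L[ℝ] ℝ) :
    ∃ v : TangentSpace I p, ∀ w, g.form p v w = l w := by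
  have : FiniteDimensional ℝ (TangentSpace I p) := inferInstanceAs (FiniteDimensional ℝ E)
  let B : TangentSpace I p →ₗ[ℝ] Module.Dual ℝ (TangentSpace I p) :=
    { toFun := fun v ↦ (g.form p v).toLinearMap
      map_add' := fun v w ↦ by ext; simp
      map_smul' := fun c v ↦ by ext; simp }
  have hB : Function.Injective B := by
    rw [injective_iff_map_eq_zero]
    intro v hv
    exact g.nondegenerate p v fun w ↦ by simpa [B] using congrArg (fun f ↦ f w) hv
  have hS : Function.Surjective B :=
    (LinearMap.injective_iff_surjective_of_finrank_eq_finrank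
      Subspace.dual_finrank_eq.symm).1 hB
  obtain ⟨v, hv⟩ := hS l.toLinearMap
  exact ⟨v, fun w ↦ by simpa [B] using congrArg (fun f ↦ f w) hv⟩

/-- The vector `v` of `T_p M` that is metrically dual to the covector `l`:
`g(v, w) = l(w)` for all `w`. -/
def sharp (p : M) (l : TangentSpace I p →L[ℝ] ℝ) : TangentSpace I p :=
  (g.exists_sharp p l).choose

theorem form_sharp (p : M) (l : TangentSpace I p →L[ℝ] ℝ) (w : TangentSpace I p) :
    g.form p (g.sharp p l) w = l w :=
  (g.exists_sharp p l).choose_spec w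

/-- The gradient of a function: `g(∇u, w) = du(w)`. -/
def gradient (u : M → ℝ) (p : M) : TangentSpace I p :=
  g.sharp p (mfderiv I 𝓘(ℝ, ℝ) u p)

/-- The Christoffel symbols of the second kind at `p`, in the chart centred at `p`,
as the tangent vector `Γ(a, b) = Γ^k_{ij} a^i b^j ∂_k`. -/
def christoffelVec (p : M) (a b : E) : TangentSpace I p :=
  g.sharp p ((g.christoffel p a b).comp (toChart I p p))

/-- The Levi-Civita covariant derivative `∇_a V` at `p`, computed in the chart centred at `p`:
`(∇_a V)^k = ∂_a V^k + Γ^k_{ij} a^i V^j`. -/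
def covDeriv (V : ∀ q : M, TangentSpace I q) (p : M) (a : TangentSpace I p) : TangentSpace I p :=
  ofChart I p p (fderiv ℝ
      (fun x ↦ toChart I p ((extChartAt I p).symm x) (V ((extChartAt I p).symm x)))
      (extChartAt I p p) (toChart I p p a))
    + g.christoffelVec p (toChart I p p a) (toChart I p p (V p))

/-- A vector field is parallel for the Levi-Civita connection if it is smooth and `∇V = 0`. -/
def IsParallel (V : ∀ q : M, TangentSpace I q) : Prop :=
  ContMDiff I (I.prod 𝓘(ℝ, E)) ∞ (fun q ↦ (⟨q, V q⟩ : TangentBundle I M)) ∧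
    ∀ p (a : TangentSpace I p), g.covDeriv V p a = 0

/-- A vector is light-like if it is nonzero and null. -/
def IsLightLike (p : M) (v : TangentSpace I p) : Prop :=
  v ≠ 0 ∧ g.form p v v = 0

/-- The covariant acceleration `∇_{γ'} γ'` of a curve at time `t`, computed in the chart centred
at `γ t`: `(γ^k)'' + Γ^k_{ij} (γ^i)' (γ^j)'`. -/
def acceleration (γ : ℝ → M) (t : ℝ) : TangentSpace I (γ t) :=
  ofChart I (γ t) (γ t) (iteratedDeriv 2 (fun s ↦ extChartAt I (γ t) (γ s)) t)
    + g.christoffelVec (γ t) (deriv (fun s ↦ extChartAt I (γ t) (γ s)) t)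
        (deriv (fun s ↦ extChartAt I (γ t) (γ s)) t)

/-- `γ` is a geodesic on the open interval `J` if it is smooth there with `∇_{γ'} γ' = 0`. -/
def IsGeodesicOn (γ : ℝ → M) (J : Set ℝ) : Prop :=
  ContMDiffOn 𝓘(ℝ, ℝ) I ∞ γ J ∧ ∀ t ∈ J, g.acceleration γ t = 0

/-- Geodesic completeness: every tangent vector is the initial velocity of a geodesic defined on
all of `ℝ`. -/
def IsComplete : Prop :=
  ∀ ξ : TangentBundle I M, ∃ γ : ℝ → M, g.IsGeodesicOn γ univ ∧
    (⟨γ 0, velocity I γ 0⟩ : TangentBundle I M) = ξ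

end SemiRiemannianMetric

end SemiRiemannian

section Cone

/-- The half-line `ℝ_{>0}`, as an open submanifold of `ℝ`. -/
def posReals : TopologicalSpace.Opens ℝ := ⟨Ioi 0, isOpen_Ioi⟩

/-- The manifold `ℝ_{>0} × M`. -/
abbrev Cone (M : Type*) : Type _ := posReals × M

variable {E : Type*} [NormedAddCommGroup E] [NormedSpace ℝ E]
  {H : Type*} [TopologicalSpace H] {I : ModelWithCorners ℝ E H}
  {M : Type*} [TopologicalSpace M] [ChartedSpace H M] [IsManifold I ∞ M]

/-- The model of the manifold `ℝ_{>0} × M`. -/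
abbrev coneModel (I : ModelWithCorners ℝ E H) : ModelWithCorners ℝ (ℝ × E) (ModelProd ℝ H) :=
  𝓘(ℝ, ℝ).prod I

/-- The differential `dr` of the projection to `ℝ_{>0}`. -/
def coneDr (I : ModelWithCorners ℝ E H) (q : Cone M) : TangentSpace (coneModel I) q →L[ℝ] ℝ :=
  ContinuousLinearMap.fst ℝ ℝ E

/-- The differential of the projection to `M`. -/
def coneDproj (I : ModelWithCorners ℝ E H) (q : Cone M) :
    TangentSpace (coneModel I) q →L[ℝ] TangentSpace I q.2 :=
  ContinuousLinearMap.snd ℝ ℝ E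

/-- The radial vector field `∂_r`. -/
def radial (I : ModelWithCorners ℝ E H) (q : Cone M) : TangentSpace (coneModel I) q :=
  ((1, 0) : ℝ × E)

/-- The bilinear form `ε dr² + r² g` at a point of the cone. -/
def coneForm (g : SemiRiemannianMetric I M) (ε : ℝ) (q : Cone M) :
    TangentSpace (coneModel I) q →L[ℝ] TangentSpace (coneModel I) q →L[ℝ] ℝ :=
  ε • pullbackForm (ContinuousLinearMap.mul ℝ ℝ) (coneDr I q)
    + (q.1 : ℝ) ^ 2 • pullbackForm (g.form q.2) (coneDproj I q)

theorem coneForm_apply (g : SemiRiemannianMetric I M) (ε : ℝ) (q : Cone M)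
    (v w : TangentSpace (coneModel I) q) :
    coneForm g ε q v w = ε * (coneDr I q v * coneDr I q w)
      + (q.1 : ℝ) ^ 2 * g.form q.2 (coneDproj I q v) (coneDproj I q w) := rfl

theorem trivializationAt_form (p q : M) (hq : q ∈ (chartAt H p).source)
    (B : TangentSpace I q →L[ℝ] TangentSpace I q →L[ℝ] ℝ) :
    (trivializationAt (E →L[ℝ] E →L[ℝ] ℝ)
      (fun p : M ↦ TangentSpace I p →L[ℝ] TangentSpace I p →L[ℝ] ℝ) p ⟨q, B⟩).2 =
      pullbackForm B (ofChart I p q) := by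
  have hq' : q ∈ (trivializationAt E (TangentSpace I) p).baseSet := by simpa using hq
  ext v w
  rw [hom_trivializationAt_apply]
  refine (inCoordinates_apply_eq₂ (F₁ := E) (F₂ := E) (F₃ := ℝ) (E₁ := TangentSpace I)
    (E₂ := TangentSpace I) (E₃ := Bundle.Trivial M ℝ) hq' hq' (Set.mem_univ _)).trans ?_
  simp only [Bundle.Trivial.fiberBundle_trivializationAt', Bundle.Trivial.linearMapAt_trivialization]
  change B _ _ = B ((trivializationAt E (TangentSpace I) p).symmL ℝ q v)
    ((trivializationAt E (TangentSpace I) p).symmL ℝ q w)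
  rw [Bundle.Trivialization.symmL_apply _ hq', Bundle.Trivialization.symmL_apply _ hq']

theorem mem_chartAt_posReals (r₀ r : posReals) : r ∈ (chartAt ℝ r₀).source := by
  simp [TopologicalSpace.Opens.chartAt_eq, chartAt_self_eq]

theorem toChart_posReals (r₀ r : posReals) :
    toChart 𝓘(ℝ, ℝ) r₀ r = ContinuousLinearMap.id ℝ ℝ := by
  unfold toChart
  rw [TangentBundle.continuousLinearMapAt_trivializationAt_eq_core (mem_chartAt_posReals r₀ r)]
  ext
  exact (tangentBundleCore 𝓘(ℝ, ℝ) posReals).coordChange_self (achart ℝ r) r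
    (mem_chartAt_posReals r r) 1

theorem mem_chartAt_cone (q₀ q : Cone M) (hq : q.2 ∈ (chartAt H q₀.2).source) :
    q ∈ (chartAt (ModelProd ℝ H) q₀).source := by
  simp [hq, mem_chartAt_posReals q₀.1 q.1]

theorem toChart_cone (q₀ q : Cone M) (hq : q.2 ∈ (chartAt H q₀.2).source)
    (w : TangentSpace (coneModel I) q) :
    toChart (coneModel I) q₀ q w = (coneDr I q w, toChart I q₀.2 q.2 (coneDproj I q w)) := by
  have hr := mem_chartAt_posReals q₀.1 q.1
  have h3 : mfderiv 𝓘(ℝ, ℝ) 𝓘(ℝ, ℝ) (extChartAt 𝓘(ℝ, ℝ) q₀.1) q.1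
      = ContinuousLinearMap.id ℝ ℝ := by
    rw [← TangentBundle.continuousLinearMapAt_trivializationAt hr]
    exact toChart_posReals q₀.1 q.1
  have h := mfderiv_prodMap (p := q) (mdifferentiableAt_extChartAt (I := 𝓘(ℝ, ℝ)) hr)
    (mdifferentiableAt_extChartAt (I := I) hq)
  rw [h3, ← modelWithCornersSelf_prod, chartedSpaceSelf_prod] at h
  unfold toChart
  rw [TangentBundle.continuousLinearMapAt_trivializationAt (mem_chartAt_cone q₀ q hq),
    TangentBundle.continuousLinearMapAt_trivializationAt hq, extChartAt_prod]
  exact congrArg (fun L : (ℝ × E) →L[ℝ] (ℝ × E) ↦ L w) h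

theorem ofChart_cone (q₀ q : Cone M) (hq : q.2 ∈ (chartAt H q₀.2).source) (v : ℝ × E) :
    ofChart (coneModel I) q₀ q v = ((v.1, ofChart I q₀.2 q.2 v.2) : ℝ × E) := by
  have h1 : q ∈ (trivializationAt (ℝ × E) (TangentSpace (coneModel I)) q₀).baseSet :=
    mem_chartAt_cone q₀ q hq
  have h2 : q.2 ∈ (trivializationAt E (TangentSpace I) q₀.2).baseSet := hq
  set w : TangentSpace (coneModel I) q := ((v.1, ofChart I q₀.2 q.2 v.2) : ℝ × E) with hw
  have h : toChart (coneModel I) q₀ q w = v := by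
    rw [toChart_cone q₀ q hq]
    refine Prod.ext rfl ?_
    exact (trivializationAt E (TangentSpace I) q₀.2).continuousLinearMapAt_symmL h2 v.2
  rw [← h]
  exact (trivializationAt (ℝ × E) (TangentSpace (coneModel I)) q₀).symmL_continuousLinearMapAt
    h1 w

theorem contMDiff_coneForm (g : SemiRiemannianMetric I M) (ε : ℝ) :
    ContMDiff (coneModel I) ((coneModel I).prod 𝓘(ℝ, (ℝ × E) →L[ℝ] (ℝ × E) →L[ℝ] ℝ)) ∞
      (fun q : Cone M ↦ Bundle.TotalSpace.mk' ((ℝ × E) →L[ℝ] (ℝ × E) →L[ℝ] ℝ)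
        (E := fun q : Cone M ↦ TangentSpace (coneModel I) q →L[ℝ]
          TangentSpace (coneModel I) q →L[ℝ] ℝ) q (coneForm g ε q)) := by
  intro q₀
  rw [Bundle.contMDiffAt_section]
  have hg := g.contMDiff q₀.2
  rw [Bundle.contMDiffAt_section] at hg
  have hg' := hg.comp q₀ (contMDiffAt_snd (I := 𝓘(ℝ, ℝ)) (J := I) (n := ∞) (p := q₀))
  have hr : ContMDiffAt (coneModel I) 𝓘(ℝ, ℝ) ∞ (fun q : Cone M ↦ (q.1 : ℝ)) q₀ :=
    (contMDiff_subtype_val (U := posReals)).contMDiffAt.comp q₀ contMDiffAt_fst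
  have hP := (contMDiffAt_const (c := ContinuousLinearMap.precomp ℝ
    (ContinuousLinearMap.snd ℝ ℝ E))).clm_comp (hg'.clm_comp
      (contMDiffAt_const (c := ContinuousLinearMap.snd ℝ ℝ E)))
  have hmain := (contMDiffAt_const (c := ε • pullbackForm (ContinuousLinearMap.mul ℝ ℝ)
    (ContinuousLinearMap.fst ℝ ℝ E))).add ((hr.pow 2).smul hP)
  refine hmain.congr_of_eventuallyEq ?_
  have hs : {q : Cone M | q.2 ∈ (chartAt H q₀.2).source} ∈ 𝓝 q₀ :=
    continuous_snd.continuousAt ((chartAt H q₀.2).open_source.mem_nhds (mem_chart_source H q₀.2))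
  filter_upwards [hs] with q hq
  rw [trivializationAt_form q₀ q (mem_chartAt_cone q₀ q hq)]
  simp only [Function.comp_apply, Pi.add_apply, Pi.smul_apply']
  rw [trivializationAt_form q₀.2 q.2 hq]
  refine ContinuousLinearMap.ext fun v ↦ ContinuousLinearMap.ext fun w ↦ ?_
  change coneForm g ε q (ofChart (coneModel I) q₀ q v) (ofChart (coneModel I) q₀ q w) = _
  rw [ofChart_cone q₀ q hq, ofChart_cone q₀ q hq]
  rfl

/-- The cone metric `ε dr² + r² g` on `ℝ_{>0} × M`, for `ε = ±1`. -/
def coneMetric (g : SemiRiemannianMetric I M) (ε : ℝ) (hε : ε = 1 ∨ ε = -1) :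
    SemiRiemannianMetric (coneModel I) (Cone M) where
  form := coneForm g ε
  symm q v w := by
    rw [coneForm_apply, coneForm_apply, g.symm, mul_comm (coneDr I q v)]
  nondegenerate q v hv := by
    have hr : (q.1 : ℝ) ≠ 0 := ne_of_gt q.1.2
    have h1 : coneDr I q v = 0 := by
      have h := hv (radial I q)
      rw [coneForm_apply, show coneDr I q (radial I q) = 1 from rfl,
        show coneDproj I q (radial I q) = 0 from rfl] at h
      rcases hε with rfl | rfl <;> simpa using h
    have h2 : coneDproj I q v = 0 := by
      apply g.nondegenerate
      intro w
      have h := hv (show TangentSpace (coneModel I) q from ((0, w) : ℝ × E))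
      rw [coneForm_apply, h1] at h
      have h' : (q.1 : ℝ) ^ 2 * g.form q.2 (coneDproj I q v) w = 0 := by
        simpa using! h
      simpa [hr] using h'
    exact Prod.ext h1 h2
  contMDiff := contMDiff_coneForm g ε

end Cone

end

section ChartComponents

variable {E : Type*} [NormedAddCommGroup E] [NormedSpace ℝ E]
  {H : Type*} [TopologicalSpace H] {I : ModelWithCorners ℝ E H}
  {M : Type*} [TopologicalSpace M] [ChartedSpace H M]

theorem eventually_extChartAt_symm_mem_source [I.Boundaryless] (p : M) :
    ∀ᶠ x in 𝓝 (extChartAt I p p), (extChartAt I p).symm x ∈ (chartAt H p).source := by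
  filter_upwards [extChartAt_target_mem_nhds (I := I) p] with x hx
  simpa using (extChartAt I p).map_target hx

theorem hasDerivAt_comp_curve {f : M → ℝ} {γ : ℝ → M} {t : ℝ}
    (hf : ContMDiffAt I 𝓘(ℝ, ℝ) ∞ f (γ t)) (hγ : ContMDiffAt 𝓘(ℝ, ℝ) I ∞ γ t) :
    HasDerivAt (f ∘ γ) (mfderiv I 𝓘(ℝ, ℝ) f (γ t) (velocity I γ t)) t := by
  have h1 : DifferentiableAt ℝ (f ∘ γ) t :=
    (contMDiffAt_iff_contDiffAt.1 (hf.comp t hγ)).differentiableAt (by simp)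
  have h2 := mfderiv_comp t (hf.mdifferentiableAt (by simp)) (hγ.mdifferentiableAt (by simp))
  refine h1.hasDerivAt.congr_deriv ?_
  rw [← fderiv_apply_one_eq_deriv, ← mfderiv_eq_fderiv]
  exact congrArg (fun L : ℝ →L[ℝ] ℝ ↦ L 1) h2

variable [IsManifold I ∞ M]

theorem toChart_ofChart {p q : M} (hq : q ∈ (chartAt H p).source) (a : E) :
    toChart I p q (ofChart I p q a) = a :=
  (trivializationAt E (TangentSpace I) p).continuousLinearMapAt_symmL hq a

theorem ofChart_toChart {p q : M} (hq : q ∈ (chartAt H p).source) (v : TangentSpace I q) :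
    ofChart I p q (toChart I p q v) = v :=
  (trivializationAt E (TangentSpace I) p).symmL_continuousLinearMapAt hq v

theorem trivializationAt_eq_toChart {p q : M} (hq : q ∈ (chartAt H p).source)
    (v : TangentSpace I q) :
    (trivializationAt E (TangentSpace I) p ⟨q, v⟩).2 = toChart I p q v := by
  have hq' : q ∈ (trivializationAt E (TangentSpace I) p).baseSet := hq
  unfold toChart
  rw [Bundle.Trivialization.continuousLinearMapAt_apply,
    Bundle.Trivialization.coe_linearMapAt_of_mem _ hq']

theorem toChart_eq_mfderiv {p q : M} (hq : q ∈ (chartAt H p).source) (v : TangentSpace I q) :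
    toChart I p q v = mfderiv I 𝓘(ℝ, E) (extChartAt I p) q v := by
  unfold toChart
  rw [TangentBundle.continuousLinearMapAt_trivializationAt hq]
  rfl

theorem contMDiffAt_extChartAt_symm [I.Boundaryless] (p : M) :
    ContMDiffAt 𝓘(ℝ, E) I ∞ (extChartAt I p).symm (extChartAt I p p) :=
  (contMDiffOn_extChartAt_symm p).contMDiffAt (extChartAt_target_mem_nhds p)

/-- A smooth function on `M` is smooth when written in the chart centred at a point. -/
theorem ContMDiffAt.contDiffAt_comp_extChartAt_symm [I.Boundaryless] {F : Type*}
    [NormedAddCommGroup F] [NormedSpace ℝ F] {f : M → F} {p : M}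
    (hf : ContMDiffAt I 𝓘(ℝ, F) ∞ f p) :
    ContDiffAt ℝ ∞ (fun x ↦ f ((extChartAt I p).symm x)) (extChartAt I p p) := by
  rw [← contMDiffAt_iff_contDiffAt]
  refine ContMDiffAt.comp (g := f) (I' := I) _ ?_ (contMDiffAt_extChartAt_symm p)
  simpa using hf

/-- The differential of a function is the derivative of its expression in the chart. -/
theorem mfderiv_eq_fderiv_toChart [I.Boundaryless] {f : M → ℝ} {p : M}
    (hf : ContMDiffAt I 𝓘(ℝ, ℝ) ∞ f p) (v : TangentSpace I p) :
    mfderiv I 𝓘(ℝ, ℝ) f p v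
      = fderiv ℝ (fun x ↦ f ((extChartAt I p).symm x)) (extChartAt I p p) (toChart I p p v) := by
  have h1 : MDifferentiableAt 𝓘(ℝ, E) 𝓘(ℝ, ℝ) (fun x ↦ f ((extChartAt I p).symm x))
      (extChartAt I p p) :=
    (hf.contDiffAt_comp_extChartAt_symm.differentiableAt (by simp)).mdifferentiableAt
  have h2 := mdifferentiableAt_extChartAt (I := I) (mem_chart_source H p)
  have h3 := mfderiv_comp p h1 h2
  have h4 : f =ᶠ[𝓝 p] (fun x ↦ f ((extChartAt I p).symm x)) ∘ extChartAt I p := by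
    filter_upwards [extChartAt_source_mem_nhds (I := I) p] with q hq
    exact congrArg f ((extChartAt I p).left_inv hq).symm
  rw [h4.mfderiv_eq, h3, toChart_eq_mfderiv (mem_chart_source H p), mfderiv_eq_fderiv]
  rfl

/-- A smooth vector field has smooth components. -/
theorem contDiffAt_toChart_vectorField [I.Boundaryless] {V : ∀ q : M, TangentSpace I q} {p : M}
    (hV : ContMDiffAt I (I.prod 𝓘(ℝ, E)) ∞ (fun q ↦ (⟨q, V q⟩ : TangentBundle I M)) p) :
    ContDiffAt ℝ ∞
      (fun x ↦ toChart I p ((extChartAt I p).symm x) (V ((extChartAt I p).symm x)))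
      (extChartAt I p p) := by
  have h := (Bundle.contMDiffAt_section (s := V) p).1 hV
  refine h.contDiffAt_comp_extChartAt_symm.congr_of_eventuallyEq ?_
  filter_upwards [eventually_extChartAt_symm_mem_source (I := I) p] with x hx
  exact (trivializationAt_eq_toChart hx _).symm

/-- The components of the velocity are the derivatives of the components of the curve. -/
theorem toChart_velocity {γ : ℝ → M} {t : ℝ} {p : M} (hγ : ContMDiffAt 𝓘(ℝ, ℝ) I ∞ γ t)
    (ht : γ t ∈ (chartAt H p).source) :
    toChart I p (γ t) (velocity I γ t) = deriv (fun s ↦ extChartAt I p (γ s)) t := by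
  have h1 := mdifferentiableAt_extChartAt (I := I) ht
  have h2 := mfderiv_comp t h1 (hγ.mdifferentiableAt (by simp))
  rw [toChart_eq_mfderiv ht, ← fderiv_apply_one_eq_deriv, ← mfderiv_eq_fderiv]
  exact (congrArg (fun L : ℝ →L[ℝ] E ↦ L 1) h2).symm

theorem contDiffAt_extChartAt_comp {γ : ℝ → M} {t : ℝ} {p : M}
    (hγ : ContMDiffAt 𝓘(ℝ, ℝ) I ∞ γ t) (ht : γ t ∈ (chartAt H p).source) :
    ContDiffAt ℝ ∞ (fun s ↦ extChartAt I p (γ s)) t := by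
  rw [← contMDiffAt_iff_contDiffAt]
  exact ContMDiffAt.comp t (contMDiffAt_extChartAt' ht) hγ

end ChartComponents

theorem hasDerivAt_deriv_of_contDiffAt {F : Type*} [NormedAddCommGroup F] [NormedSpace ℝ F]
    {x : ℝ → F} {t : ℝ} (hx : ContDiffAt ℝ ∞ x t) :
    HasDerivAt (deriv x) (iteratedDeriv 2 x t) t := by
  have h : DifferentiableAt ℝ (deriv x) t :=
    ((hx.fderiv_right (m := 1) (by norm_cast)).differentiableAt (by simp)).clm_apply
      (differentiableAt_const 1)
  rw [iteratedDeriv_succ, iteratedDeriv_one]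
  exact h.hasDerivAt

/-- The derivative of `t ↦ B(t)(v(t), w(t))`. -/
theorem hasDerivAt_bilinear {F : Type*} [NormedAddCommGroup F] [NormedSpace ℝ F]
    {B : ℝ → F →L[ℝ] F →L[ℝ] ℝ} {B' : F →L[ℝ] F →L[ℝ] ℝ} {v w : ℝ → F} {v' w' : F} {t : ℝ}
    (hB : HasDerivAt B B' t) (hv : HasDerivAt v v' t) (hw : HasDerivAt w w' t) :
    HasDerivAt (fun s ↦ B s (v s) (w s)) (B' (v t) (w t) + B t v' (w t) + B t (v t) w') t := by
  simpa [add_assoc] using (hB.clm_apply hv).clm_apply hw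

namespace SemiRiemannianMetric

variable {E : Type*} [NormedAddCommGroup E] [NormedSpace ℝ E]
  {H : Type*} [TopologicalSpace H] {I : ModelWithCorners ℝ E H}
  {M : Type*} [TopologicalSpace M] [ChartedSpace H M] [IsManifold I ∞ M]
  (g : SemiRiemannianMetric I M)

theorem inChart_extChartAt {p q : M} (hq : q ∈ (chartAt H p).source) (a b : E) :
    g.inChart p (extChartAt I p q) a b = g.form q (ofChart I p q a) (ofChart I p q b) := by
  unfold inChart
  rw [(extChartAt I p).left_inv (by simpa using hq)]
  rfl

theorem form_eq_inChart {p q : M} (hq : q ∈ (chartAt H p).source) (v w : TangentSpace I q) :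
    g.form q v w = g.inChart p (extChartAt I p q) (toChart I p q v) (toChart I p q w) := by
  rw [g.inChart_extChartAt hq, ofChart_toChart hq, ofChart_toChart hq]

theorem inChart_symm (p : M) (x a b : E) : g.inChart p x a b = g.inChart p x b a :=
  g.symm _ _ _

theorem contDiffAt_inChart [I.Boundaryless] (p : M) :
    ContDiffAt ℝ ∞ (g.inChart p) (extChartAt I p p) := by
  have h := (Bundle.contMDiffAt_section (s := g.form) p).1 (g.contMDiff p)
  refine h.contDiffAt_comp_extChartAt_symm.congr_of_eventuallyEq ?_
  filter_upwards [eventually_extChartAt_symm_mem_source (I := I) p] with x hx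
  exact (trivializationAt_form p _ hx _).symm

theorem hasFDerivAt_inChart [I.Boundaryless] (p : M) :
    HasFDerivAt (g.inChart p) (fderiv ℝ (g.inChart p) (extChartAt I p p)) (extChartAt I p p) :=
  ((g.contDiffAt_inChart p).differentiableAt (by simp)).hasFDerivAt

theorem hasFDerivAt_inChart_apply [I.Boundaryless] (p : M) (b c : E) :
    HasFDerivAt (fun x ↦ g.inChart p x b c)
      (((fderiv ℝ (g.inChart p) (extChartAt I p p)).flip b).flip c) (extChartAt I p p) := by
  have h := ((g.hasFDerivAt_inChart p).clm_apply
    (hasFDerivAt_const b _)).clm_apply (hasFDerivAt_const c _)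
  convert! h using 1
  ext a
  simp

theorem fderiv_inChart_symm [I.Boundaryless] (p : M) (a b c : E) :
    fderiv ℝ (g.inChart p) (extChartAt I p p) a b c
      = fderiv ℝ (g.inChart p) (extChartAt I p p) a c b := by
  have h1 : (fun x ↦ g.inChart p x b c) = fun x ↦ g.inChart p x c b := by
    funext x
    exact g.inChart_symm p x b c
  have h2 := (g.hasFDerivAt_inChart_apply p b c).unique
    (h1 ▸ g.hasFDerivAt_inChart_apply p c b)
  exact congrArg (fun L : E →L[ℝ] ℝ ↦ L a) h2

theorem christoffel_apply (p : M) (a b c : E) :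
    g.christoffel p a b c = 1 / 2 * (fderiv ℝ (g.inChart p) (extChartAt I p p) a b c
      + fderiv ℝ (g.inChart p) (extChartAt I p p) b a c
      - fderiv ℝ (g.inChart p) (extChartAt I p p) c a b) := by
  simp [christoffel, christoffelFirst]

variable [FiniteDimensional ℝ E]

/-- The equation `∇V = 0` with the free index lowered, in the chart. -/
theorem inChart_fderiv_of_covDeriv_eq_zero {V : ∀ q : M, TangentSpace I q} {p : M}
    (hV : ∀ a : TangentSpace I p, g.covDeriv V p a = 0) (a c : E) :
    g.inChart p (extChartAt I p p) (fderiv ℝ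
      (fun x ↦ toChart I p ((extChartAt I p).symm x) (V ((extChartAt I p).symm x)))
      (extChartAt I p p) a) c + g.christoffel p a (toChart I p p (V p)) c = 0 := by
  have hp := mem_chart_source H p
  have h := congrArg (fun v ↦ g.form p v (ofChart I p p c)) (hV (ofChart I p p a))
  simp only [covDeriv, map_add, add_apply, christoffelVec, form_sharp,
    ContinuousLinearMap.comp_apply, toChart_ofChart hp, map_zero,
    zero_apply] at h
  rw [g.inChart_extChartAt hp]
  exact h

/-- The geodesic equation with the free index lowered, in the chart. -/
theorem inChart_of_acceleration_eq_zero {γ : ℝ → M} {t : ℝ} (h : g.acceleration γ t = 0) (c : E) :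
    g.inChart (γ t) (extChartAt I (γ t) (γ t))
        (iteratedDeriv 2 (fun s ↦ extChartAt I (γ t) (γ s)) t) c
      + g.christoffel (γ t) (deriv (fun s ↦ extChartAt I (γ t) (γ s)) t)
        (deriv (fun s ↦ extChartAt I (γ t) (γ s)) t) c = 0 := by
  have hp := mem_chart_source H (γ t)
  have h := congrArg (fun v ↦ g.form (γ t) v (ofChart I (γ t) (γ t) c)) h
  simp only [acceleration, map_add, add_apply, christoffelVec, form_sharp,
    ContinuousLinearMap.comp_apply, toChart_ofChart hp, map_zero,
    zero_apply] at h
  rw [g.inChart_extChartAt hp]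
  exact h

variable [I.Boundaryless]

/-- A vector field along a geodesic paired with the velocity, differentiated in the chart. -/
theorem hasDerivAt_form_velocity {γ : ℝ → M} {t : ℝ}
    (hsm : ∀ᶠ s in 𝓝 t, ContMDiffAt 𝓘(ℝ, ℝ) I ∞ γ s)
    (hacc : g.acceleration γ t = 0) {W : ∀ s, TangentSpace I (γ s)} {w' : E}
    (hW : HasDerivAt (fun s ↦ toChart I (γ t) (γ s) (W s)) w' t) :
    HasDerivAt (fun s ↦ g.form (γ s) (W s) (velocity I γ s))
      (g.inChart (γ t) (extChartAt I (γ t) (γ t)) w' (toChart I (γ t) (γ t) (velocity I γ t))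
        + g.christoffel (γ t) (toChart I (γ t) (γ t) (velocity I γ t))
          (toChart I (γ t) (γ t) (W t)) (toChart I (γ t) (γ t) (velocity I γ t))) t := by
  have hγ := hsm.self_of_nhds
  have hp := mem_chart_source H (γ t)
  have hx := contDiffAt_extChartAt_comp hγ hp
  have hx1 : HasDerivAt (fun s ↦ extChartAt I (γ t) (γ s))
      (deriv (fun s ↦ extChartAt I (γ t) (γ s)) t) t :=
    (hx.differentiableAt (by simp)).hasDerivAt
  have hG := HasFDerivAt.comp_hasDerivAt (l := g.inChart (γ t)) t
    (g.hasFDerivAt_inChart (γ t)) hx1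
  have hmain := hasDerivAt_bilinear hG hW (hasDerivAt_deriv_of_contDiffAt hx)
  have hsrc : ∀ᶠ s in 𝓝 t, γ s ∈ (chartAt H (γ t)).source :=
    hγ.continuousAt ((chartAt H (γ t)).open_source.mem_nhds hp)
  have heq : (fun s ↦ g.form (γ s) (W s) (velocity I γ s)) =ᶠ[𝓝 t]
      fun s ↦ (g.inChart (γ t) ∘ fun s ↦ extChartAt I (γ t) (γ s)) s
        (toChart I (γ t) (γ s) (W s)) (deriv (fun s ↦ extChartAt I (γ t) (γ s)) s) := by
    filter_upwards [hsrc, hsm] with s hs hs'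
    rw [g.form_eq_inChart hs, toChart_velocity hs' hs]
    rfl
  refine (hmain.congr_of_eventuallyEq heq).congr_deriv ?_
  rw [toChart_velocity hγ hp]
  have h2 := g.inChart_of_acceleration_eq_zero hacc (toChart I (γ t) (γ t) (W t))
  have h3 (a b : E) := g.inChart_symm (γ t) (extChartAt I (γ t) (γ t)) a b
  have h4 := g.fderiv_inChart_symm (γ t)
  rw [g.christoffel_apply] at h2 ⊢
  simp only [Function.comp_apply]
  rw [h3 (toChart I (γ t) (γ t) (W t)),
    h4 _ (toChart I (γ t) (γ t) (W t)) (deriv (fun s ↦ extChartAt I (γ t) (γ s)) t)] at *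
  linarith

/-- Geodesics have constant speed. -/
theorem IsGeodesicOn.form_velocity_eq {γ : ℝ → M} {J : Set ℝ} (hγ : g.IsGeodesicOn γ J)
    (hJ : IsOpen J) (hJc : J.OrdConnected) {s t : ℝ} (hs : s ∈ J) (ht : t ∈ J) :
    g.form (γ s) (velocity I γ s) (velocity I γ s)
      = g.form (γ t) (velocity I γ t) (velocity I γ t) := by
  have hd : ∀ t ∈ J, HasDerivAt (fun s ↦ g.form (γ s) (velocity I γ s) (velocity I γ s)) 0 t := by
    intro t ht
    have hsm : ∀ᶠ s in 𝓝 t, ContMDiffAt 𝓘(ℝ, ℝ) I ∞ γ s := by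
      filter_upwards [hJ.mem_nhds ht] with s hs
      exact hγ.1.contMDiffAt (hJ.mem_nhds hs)
    have hp := mem_chart_source H (γ t)
    have hsrc : ∀ᶠ s in 𝓝 t, γ s ∈ (chartAt H (γ t)).source :=
      hsm.self_of_nhds.continuousAt ((chartAt H (γ t)).open_source.mem_nhds hp)
    have hW : HasDerivAt (fun s ↦ toChart I (γ t) (γ s) (velocity I γ s))
        (iteratedDeriv 2 (fun s ↦ extChartAt I (γ t) (γ s)) t) t := by
      refine (hasDerivAt_deriv_of_contDiffAt
        (contDiffAt_extChartAt_comp hsm.self_of_nhds hp)).congr_of_eventuallyEq ?_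
      filter_upwards [hsrc, hsm] with s hs hs'
      exact toChart_velocity hs' hs
    refine (g.hasDerivAt_form_velocity hsm (hγ.2 t ht) hW).congr_deriv ?_
    rw [toChart_velocity hsm.self_of_nhds hp]
    exact g.inChart_of_acceleration_eq_zero (hγ.2 t ht) _
  exact hJ.is_const_of_deriv_eq_zero hJc.isPreconnected
    (fun t ht ↦ (hd t ht).differentiableAt.differentiableWithinAt) (fun t ht ↦ (hd t ht).deriv)
    hs ht

end SemiRiemannianMetric

/-- The solutions of `f'' = f` on an interval. -/
theorem eq_cosh_add_sinh_of_hasDerivAt {J : Set ℝ} (hJ : IsOpen J) (hJc : J.OrdConnected)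
    (h0 : (0 : ℝ) ∈ J) {f f' : ℝ → ℝ} (hf : ∀ t ∈ J, HasDerivAt f (f' t) t)
    (hf' : ∀ t ∈ J, HasDerivAt f' (f t) t) {t : ℝ} (ht : t ∈ J) :
    f t = f 0 * Real.cosh t + f' 0 * Real.sinh t := by
  have key (F : ℝ → ℝ) (hF : ∀ t ∈ J, HasDerivAt F 0 t) : F t = F 0 :=
    hJ.is_const_of_deriv_eq_zero hJc.isPreconnected
      (fun t ht ↦ (hF t ht).differentiableAt.differentiableWithinAt)
      (fun t ht ↦ (hF t ht).deriv) ht h0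
  have h1 := key (fun t ↦ f t * Real.cosh t - f' t * Real.sinh t) fun t ht ↦
    (((hf t ht).mul (Real.hasDerivAt_cosh t)).sub
      ((hf' t ht).mul (Real.hasDerivAt_sinh t))).congr_deriv (by ring)
  have h2 := key (fun t ↦ f' t * Real.cosh t - f t * Real.sinh t) fun t ht ↦
    (((hf' t ht).mul (Real.hasDerivAt_cosh t)).sub
      ((hf t ht).mul (Real.hasDerivAt_sinh t))).congr_deriv (by ring)
  simp only [Real.cosh_zero, Real.sinh_zero, mul_one, mul_zero, sub_zero] at h1 h2
  rw [← h1, ← h2]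
  linear_combination (-f t) * Real.cosh_sq_sub_sinh_sq t

section ConeGeometry

variable {E : Type*} [NormedAddCommGroup E] [NormedSpace ℝ E]
  {H : Type*} [TopologicalSpace H] {I : ModelWithCorners ℝ E H}
  {M : Type*} [TopologicalSpace M] [ChartedSpace H M]

theorem extChartAt_posReals (r₀ r : posReals) : extChartAt 𝓘(ℝ, ℝ) r₀ r = (r : ℝ) := by
  simp [TopologicalSpace.Opens.chartAt_eq, chartAt_self_eq]

theorem mem_extChartAt_posReals_target (r₀ : posReals) {s : ℝ} (hs : 0 < s) :
    s ∈ (extChartAt 𝓘(ℝ, ℝ) r₀).target := by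
  have h := (extChartAt 𝓘(ℝ, ℝ) r₀).map_source (x := (⟨s, hs⟩ : posReals))
    (by simpa using mem_chartAt_posReals r₀ ⟨s, hs⟩)
  rwa [extChartAt_posReals] at h

theorem coe_extChartAt_posReals_symm (r₀ : posReals) {s : ℝ} (hs : 0 < s) :
    ((extChartAt 𝓘(ℝ, ℝ) r₀).symm s : ℝ) = s := by
  rw [← extChartAt_posReals r₀,
    (extChartAt 𝓘(ℝ, ℝ) r₀).right_inv (mem_extChartAt_posReals_target r₀ hs)]

theorem extChartAt_posReals_symm (r₀ r : posReals) :
    (extChartAt 𝓘(ℝ, ℝ) r₀).symm (r : ℝ) = r :=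
  Subtype.ext (coe_extChartAt_posReals_symm r₀ r.2)

theorem extChartAt_cone (q₀ q : Cone M) :
    extChartAt (coneModel I) q₀ q = ((q.1 : ℝ), extChartAt I q₀.2 q.2) := by
  rw [extChartAt_prod]
  exact Prod.ext (extChartAt_posReals _ _) rfl

theorem extChartAt_cone_symm (q₀ : Cone M) (y : ℝ × E) :
    (extChartAt (coneModel I) q₀).symm y
      = ((extChartAt 𝓘(ℝ, ℝ) q₀.1).symm y.1, (extChartAt I q₀.2).symm y.2) := by
  rw [extChartAt_prod]
  rfl

variable [IsManifold I ∞ M] [I.Boundaryless]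
  (g : SemiRiemannianMetric I M) (ε : ℝ) (hε : ε = 1 ∨ ε = -1)

theorem inChart_coneMetric_eventuallyEq (q : Cone M) (β ζ : ℝ × E) :
    (fun y ↦ (coneMetric g ε hε).inChart q y β ζ) =ᶠ[𝓝 (extChartAt (coneModel I) q q)]
      fun y ↦ ε * (β.1 * ζ.1) + y.1 ^ 2 * g.inChart q.2 y.2 β.2 ζ.2 := by
  have h1 : ∀ᶠ y : ℝ × E in 𝓝 (extChartAt (coneModel I) q q), 0 < y.1 := by
    rw [extChartAt_cone]
    exact (continuous_fst.tendsto ((q.1 : ℝ), extChartAt I q.2 q.2)).eventually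
      (lt_mem_nhds q.1.2)
  have h2 : ∀ᶠ y : ℝ × E in 𝓝 (extChartAt (coneModel I) q q),
      (extChartAt I q.2).symm y.2 ∈ (chartAt H q.2).source := by
    rw [extChartAt_cone]
    exact (continuous_snd.tendsto ((q.1 : ℝ), extChartAt I q.2 q.2)).eventually
      (eventually_extChartAt_symm_mem_source (I := I) q.2)
  filter_upwards [h1, h2] with y hy1 hy2
  have h3 : (coneMetric g ε hε).inChart q y β ζ
      = coneForm g ε ((extChartAt (coneModel I) q).symm y)
        (ofChart (coneModel I) q ((extChartAt (coneModel I) q).symm y) β)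
        (ofChart (coneModel I) q ((extChartAt (coneModel I) q).symm y) ζ) := rfl
  rw [h3, extChartAt_cone_symm, ofChart_cone q (_, _) hy2, ofChart_cone q (_, _) hy2]
  refine (coneForm_apply g ε _ _ _).trans ?_
  change _ + ((extChartAt 𝓘(ℝ, ℝ) q.1).symm y.1 : ℝ) ^ 2 * _ = _
  rw [coe_extChartAt_posReals_symm _ hy1]
  rfl

theorem inChart_coneMetric (q : Cone M) (β ζ : ℝ × E) :
    (coneMetric g ε hε).inChart q (extChartAt (coneModel I) q q) β ζ
      = ε * (β.1 * ζ.1)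
        + (q.1 : ℝ) ^ 2 * g.inChart q.2 (extChartAt I q.2 q.2) β.2 ζ.2 := by
  have h := (inChart_coneMetric_eventuallyEq g ε hε q β ζ).self_of_nhds
  rwa [extChartAt_cone] at h ⊢

theorem fderiv_inChart_coneMetric (q : Cone M) (α β ζ : ℝ × E) :
    fderiv ℝ ((coneMetric g ε hε).inChart q) (extChartAt (coneModel I) q q) α β ζ
      = 2 * (q.1 : ℝ) * α.1 * g.inChart q.2 (extChartAt I q.2 q.2) β.2 ζ.2
        + (q.1 : ℝ) ^ 2
          * fderiv ℝ (g.inChart q.2) (extChartAt I q.2 q.2) α.2 β.2 ζ.2 := by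
  have h1 := (coneMetric g ε hε).hasFDerivAt_inChart_apply q β ζ
  have h2 : HasFDerivAt (fun y : ℝ × E ↦ g.inChart q.2 y.2 β.2 ζ.2)
      ((((fderiv ℝ (g.inChart q.2) (extChartAt I q.2 q.2)).flip β.2).flip ζ.2).comp
        (ContinuousLinearMap.snd ℝ ℝ E)) (extChartAt (coneModel I) q q) := by
    have h := g.hasFDerivAt_inChart_apply q.2 β.2 ζ.2
    have hy : (extChartAt (coneModel I) q q).2 = extChartAt I q.2 q.2 := by
      rw [extChartAt_cone]
    rw [← hy] at h ⊢
    exact HasFDerivAt.comp (g := fun x ↦ g.inChart q.2 x β.2 ζ.2) _ h hasFDerivAt_snd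
  have h3 : HasFDerivAt (fun y : ℝ × E ↦ y.1 ^ 2) _ (extChartAt (coneModel I) q q) :=
    (hasFDerivAt_fst (𝕜 := ℝ)).pow 2
  have h4 := ((h3.mul h2).const_add (ε * (β.1 * ζ.1))).congr_of_eventuallyEq
    (inChart_coneMetric_eventuallyEq g ε hε q β ζ)
  have h5 := congrArg (fun L : (ℝ × E) →L[ℝ] ℝ ↦ L α) (h1.unique h4)
  have hy1 : (extChartAt (coneModel I) q q).1 = (q.1 : ℝ) := by rw [extChartAt_cone]
  have hy2 : (extChartAt (coneModel I) q q).2 = extChartAt I q.2 q.2 := by rw [extChartAt_cone]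
  simp only [ContinuousLinearMap.flip_apply, add_apply, smul_apply,
    ContinuousLinearMap.comp_apply, ContinuousLinearMap.coe_snd', ContinuousLinearMap.coe_fst',
    hy1, hy2, smul_eq_mul] at h5
  rw [h5]
  simp
  ring

theorem christoffel_coneMetric (q : Cone M) (α β ζ : ℝ × E) :
    (coneMetric g ε hε).christoffel q α β ζ
      = (q.1 : ℝ) * α.1 * g.inChart q.2 (extChartAt I q.2 q.2) β.2 ζ.2
        + (q.1 : ℝ) * β.1 * g.inChart q.2 (extChartAt I q.2 q.2) α.2 ζ.2
        - (q.1 : ℝ) * ζ.1 * g.inChart q.2 (extChartAt I q.2 q.2) α.2 β.2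
        + (q.1 : ℝ) ^ 2 * g.christoffel q.2 α.2 β.2 ζ.2 := by
  simp only [SemiRiemannianMetric.christoffel_apply, fderiv_inChart_coneMetric]
  ring

end ConeGeometry

/-- The radius `1`. -/
def unitRadius : posReals := ⟨1, show (0 : ℝ) < 1 from one_pos⟩

section ParallelOnCone

variable {E : Type*} [NormedAddCommGroup E] [NormedSpace ℝ E]
  {H : Type*} [TopologicalSpace H] {I : ModelWithCorners ℝ E H}
  {M : Type*} [TopologicalSpace M] [ChartedSpace H M] [IsManifold I ∞ M]

theorem form_coneMetric_radial (g : SemiRiemannianMetric I M) (ε : ℝ) (hε : ε = 1 ∨ ε = -1)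
    (q : Cone M) (v : TangentSpace (coneModel I) q) :
    (coneMetric g ε hε).form q v (radial I q) = ε * coneDr I q v := by
  refine (coneForm_apply g ε q v (radial I q)).trans ?_
  rw [show coneDr I q (radial I q) = 1 from rfl, show coneDproj I q (radial I q) = 0 from rfl]
  simp

theorem contMDiff_coneDr {V : ∀ q : Cone M, TangentSpace (coneModel I) q}
    (hV : ContMDiff (coneModel I) ((coneModel I).prod 𝓘(ℝ, ℝ × E)) ∞
      (fun q ↦ (⟨q, V q⟩ : TangentBundle (coneModel I) (Cone M)))) :
    ContMDiff (coneModel I) 𝓘(ℝ, ℝ) ∞ (fun q ↦ coneDr I q (V q)) := by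
  intro q₀
  have h := (Bundle.contMDiffAt_section (s := V) q₀).1 (hV q₀)
  have h1 := (ContinuousLinearMap.fst ℝ ℝ E).contMDiff.contMDiffAt.comp (n := ∞) q₀ h
  refine h1.congr_of_eventuallyEq ?_
  have hs : {q : Cone M | q.2 ∈ (chartAt H q₀.2).source} ∈ 𝓝 q₀ :=
    continuous_snd.continuousAt ((chartAt H q₀.2).open_source.mem_nhds (mem_chart_source H q₀.2))
  filter_upwards [hs] with q hq
  have h2 := trivializationAt_eq_toChart (I := coneModel I) (mem_chartAt_cone q₀ q hq) (V q)
  rw [toChart_cone q₀ q hq] at h2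
  exact (congrArg Prod.fst h2).symm

variable [I.Boundaryless] [FiniteDimensional ℝ E]
  (g : SemiRiemannianMetric I M) {ε : ℝ} {hε : ε = 1 ∨ ε = -1}
  {V : ∀ q : Cone M, TangentSpace (coneModel I) q}

/-- The components of a vector field on the cone in the chart centred at `q`. -/
noncomputable def coneComponents (V : ∀ q : Cone M, TangentSpace (coneModel I) q) (q : Cone M) (y : ℝ × E) :
    ℝ × E :=
  toChart (coneModel I) q ((extChartAt (coneModel I) q).symm y)
    (V ((extChartAt (coneModel I) q).symm y))

theorem hasFDerivAt_coneComponents (hpar : (coneMetric g ε hε).IsParallel V) (q : Cone M) :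
    HasFDerivAt (coneComponents V q)
      (fderiv ℝ (coneComponents V q) (extChartAt (coneModel I) q q))
      (extChartAt (coneModel I) q q) :=
  ((contDiffAt_toChart_vectorField (hpar.1 q)).differentiableAt (by simp)).hasFDerivAt

/-- The equation `∇V = 0` on the cone in terms of the geometry of the base. -/
theorem coneComponents_equation (hpar : (coneMetric g ε hε).IsParallel V) (q : Cone M)
    (α ζ : ℝ × E) :
    ε * ((fderiv ℝ (coneComponents V q) (extChartAt (coneModel I) q q) α).1 * ζ.1)
      + (q.1 : ℝ) ^ 2 * g.inChart q.2 (extChartAt I q.2 q.2)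
        (fderiv ℝ (coneComponents V q) (extChartAt (coneModel I) q q) α).2 ζ.2
      + ((q.1 : ℝ) * α.1 * g.inChart q.2 (extChartAt I q.2 q.2)
          (toChart I q.2 q.2 (coneDproj I q (V q))) ζ.2
        + (q.1 : ℝ) * coneDr I q (V q) * g.inChart q.2 (extChartAt I q.2 q.2) α.2 ζ.2
        - (q.1 : ℝ) * ζ.1 * g.inChart q.2 (extChartAt I q.2 q.2) α.2
          (toChart I q.2 q.2 (coneDproj I q (V q)))
        + (q.1 : ℝ) ^ 2 * g.christoffel q.2 α.2
          (toChart I q.2 q.2 (coneDproj I q (V q))) ζ.2) = 0 := by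
  have h := (coneMetric g ε hε).inChart_fderiv_of_covDeriv_eq_zero (hpar.2 q) α ζ
  rw [inChart_coneMetric, christoffel_coneMetric, toChart_cone q q (mem_chart_source H q.2)] at h
  exact h

theorem mfderiv_coneDr (hpar : (coneMetric g ε hε).IsParallel V) (q : Cone M)
    (w : TangentSpace (coneModel I) q) :
    mfderiv (coneModel I) 𝓘(ℝ, ℝ) (fun q ↦ ε * coneDr I q (V q)) q w
      = (q.1 : ℝ) * g.form q.2 (coneDproj I q (V q)) (coneDproj I q w) := by
  have hq := mem_chart_source H q.2
  have hsm : ContMDiffAt (coneModel I) 𝓘(ℝ, ℝ) ∞ (fun q ↦ ε * coneDr I q (V q)) q :=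
    (contMDiff_const (c := ε)).mul (contMDiff_coneDr hpar.1) q
  have h1 : HasFDerivAt (fun y ↦ ε * (coneComponents V q y).1) _
      (extChartAt (coneModel I) q q) := (hasFDerivAt_coneComponents g hpar q).fst.const_mul ε
  have h2 : (fun y ↦ ε * coneDr I ((extChartAt (coneModel I) q).symm y)
      (V ((extChartAt (coneModel I) q).symm y))) =ᶠ[𝓝 (extChartAt (coneModel I) q q)]
      fun y ↦ ε * (coneComponents V q y).1 := by
    filter_upwards [eventually_extChartAt_symm_mem_source (I := coneModel I) q] with y hy
    have hy' : ((extChartAt (coneModel I) q).symm y).2 ∈ (chartAt H q.2).source := by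
      simpa using hy.2
    rw [coneComponents, toChart_cone q _ hy']
  rw [mfderiv_eq_fderiv_toChart hsm, h2.fderiv_eq, h1.fderiv, g.form_eq_inChart hq,
    g.inChart_symm]
  have h3 := coneComponents_equation g hpar q (toChart (coneModel I) q q w) (1, 0)
  rw [toChart_cone q q hq] at h3 ⊢
  simp only [map_zero, mul_zero, mul_one, add_zero, zero_sub] at h3
  rw [← sub_eq_add_neg, sub_eq_zero] at h3
  exact h3

theorem coneDr_eq_one (hpar : (coneMetric g ε hε).IsParallel V) (q : Cone M) :
    ε * coneDr I q (V q) = ε * coneDr I (unitRadius, q.2) (V (unitRadius, q.2)) := by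
  obtain ⟨r, p⟩ := q
  set F : Cone M → ℝ := fun q ↦ ε * coneDr I q (V q)
  have hFs : ContMDiff (coneModel I) 𝓘(ℝ, ℝ) ∞ F :=
    (contMDiff_const (c := ε)).mul (contMDiff_coneDr hpar.1)
  let c : ℝ → posReals := (extChartAt 𝓘(ℝ, ℝ) unitRadius).symm
  have hd : ∀ s ∈ Ioi (0 : ℝ), HasDerivAt (F ∘ fun s ↦ (c s, p)) 0 s := by
    intro s hs
    have hc : ContMDiffAt 𝓘(ℝ, ℝ) 𝓘(ℝ, ℝ) ∞ c s := by
      exact (contMDiffOn_extChartAt_symm _).contMDiffAt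
        (extChartAt_target_mem_nhds' (mem_extChartAt_posReals_target unitRadius hs))
    have hcurve : ContMDiffAt 𝓘(ℝ, ℝ) (coneModel I) ∞ (fun s ↦ (c s, p)) s :=
      hc.prodMk contMDiffAt_const
    refine (hasDerivAt_comp_curve (hFs _) hcurve).congr_deriv ?_
    rw [mfderiv_coneDr g hpar]
    have hz : coneDproj I (c s, p) (velocity (coneModel I) (fun s ↦ (c s, p)) s) = 0 := by
      unfold velocity
      rw [mfderiv_prodMk (hc.mdifferentiableAt (by simp)) mdifferentiableAt_const, mfderiv_const]
      rfl
    rw [hz]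
    simp
  have h := isOpen_Ioi.is_const_of_deriv_eq_zero (convex_Ioi (0 : ℝ)).isPreconnected
    (fun t ht ↦ (hd t ht).differentiableAt.differentiableWithinAt) (fun t ht ↦ (hd t ht).deriv)
    r.2 (mem_Ioi.2 one_pos)
  have h1 (r : posReals) : c (r : ℝ) = r := extChartAt_posReals_symm unitRadius r
  simp only [Function.comp_apply] at h
  rwa [h1, show c 1 = unitRadius from h1 unitRadius] at h

end ParallelOnCone

section RadialComponent

variable {E : Type*} [NormedAddCommGroup E] [NormedSpace ℝ E]
  {H : Type*} [TopologicalSpace H] {I : ModelWithCorners ℝ E H}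
  {M : Type*} [TopologicalSpace M] [ChartedSpace H M] [IsManifold I ∞ M]

/-- The function `ĝ(V, ∂_r) = ε dr(V)` on the hypersurface `r = 1`. -/
noncomputable def radialComponent (ε : ℝ) (V : ∀ q : Cone M, TangentSpace (coneModel I) q)
    (p : M) : ℝ :=
  ε * coneDr I (unitRadius, p) (V (unitRadius, p))

/-- The component of `V` tangent to `M` on the hypersurface `r = 1`. -/
noncomputable def tangentialPart (V : ∀ q : Cone M, TangentSpace (coneModel I) q)
    (p : M) : TangentSpace I p :=
  coneDproj I (unitRadius, p) (V (unitRadius, p))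

variable (g : SemiRiemannianMetric I M) {ε : ℝ} {hε : ε = 1 ∨ ε = -1}
  {V : ∀ q : Cone M, TangentSpace (coneModel I) q}

/-- If `V` is null, then `g(∇u, ∇u) = -ε u²`. -/
theorem form_tangentialPart {p : M}
    (hnull : (coneMetric g ε hε).form (unitRadius, p) (V (unitRadius, p)) (V (unitRadius, p)) = 0) :
    g.form p (tangentialPart V p) (tangentialPart V p) = -ε * radialComponent ε V p ^ 2 := by
  have h := (coneForm_apply g ε (unitRadius, p) _ _).symm.trans hnull
  have h1 : ((unitRadius : posReals) : ℝ) = 1 := rfl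
  have h2 : ε ^ 2 = 1 := by rcases hε with rfl | rfl <;> norm_num
  simp only [h1, one_pow, one_mul] at h
  unfold radialComponent
  rw [tangentialPart]
  linear_combination h + ε * coneDr I (unitRadius, p) (V (unitRadius, p)) ^ 2 * h2

variable [FiniteDimensional ℝ E]

theorem contMDiff_radialComponent (hpar : (coneMetric g ε hε).IsParallel V) :
    ContMDiff I 𝓘(ℝ, ℝ) ∞ (radialComponent ε V) :=
  ((contMDiff_const (c := ε)).mul (contMDiff_coneDr hpar.1)).comp
    (contMDiff_const.prodMk contMDiff_id)

variable [I.Boundaryless]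

theorem mfderiv_radialComponent (hpar : (coneMetric g ε hε).IsParallel V) (p : M)
    (v : TangentSpace I p) :
    mfderiv I 𝓘(ℝ, ℝ) (radialComponent ε V) p v = g.form p (tangentialPart V p) v := by
  have h1 : ContMDiff (coneModel I) 𝓘(ℝ, ℝ) ∞ (fun q : Cone M ↦ ε * coneDr I q (V q)) :=
    (contMDiff_const (c := ε)).mul (contMDiff_coneDr hpar.1)
  have h3 : mfderiv I (coneModel I) (fun p : M ↦ ((unitRadius, id p) : Cone M)) p v
      = ((0, v) : ℝ × E) := by
    rw [mfderiv_prodMk mdifferentiableAt_const mdifferentiableAt_id, mfderiv_const,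
      mfderiv_id]
    rfl
  have h2 := mfderiv_comp (I' := coneModel I) p
    (h1.mdifferentiable (by simp) ((unitRadius, p) : Cone M))
    ((contMDiff_const (c := unitRadius)).prodMk
      (contMDiff_id (I := I) (n := ∞)) |>.mdifferentiable (by simp) p)
  have h4 := congrArg (fun L : E →L[ℝ] ℝ ↦ L v) h2
  refine h4.trans ?_
  refine (congrArg (mfderiv (coneModel I) 𝓘(ℝ, ℝ) (fun q : Cone M ↦ ε * coneDr I q (V q))
    (unitRadius, p)) h3).trans ?_
  refine (mfderiv_coneDr g hpar (unitRadius, p) _).trans ?_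
  exact one_mul (g.form p (tangentialPart V p) v)

theorem gradient_radialComponent (hpar : (coneMetric g ε hε).IsParallel V) (p : M) :
    g.gradient (radialComponent ε V) p = tangentialPart V p := by
  rw [← sub_eq_zero]
  refine g.nondegenerate p _ fun w ↦ ?_
  have h : g.form p (g.gradient (radialComponent ε V) p) w = g.form p (tangentialPart V p) w :=
    (g.form_sharp p _ w).trans (mfderiv_radialComponent g hpar p w)
  rw [map_sub, sub_apply, h, sub_self]

/-- The Hessian equation `∇²u = -ε u g`, along a geodesic. -/
theorem hasDerivAt_form_tangentialPart_velocity (hpar : (coneMetric g ε hε).IsParallel V)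
    {γ : ℝ → M} {t : ℝ} (hsm : ∀ᶠ s in 𝓝 t, ContMDiffAt 𝓘(ℝ, ℝ) I ∞ γ s)
    (hacc : g.acceleration γ t = 0) :
    HasDerivAt (fun s ↦ g.form (γ s) (tangentialPart V (γ s)) (velocity I γ s))
      (-ε * radialComponent ε V (γ t)
        * g.form (γ t) (velocity I γ t) (velocity I γ t)) t := by
  have hγ := hsm.self_of_nhds
  have hp := mem_chart_source H (γ t)
  have hx := contDiffAt_extChartAt_comp hγ hp
  have hsrc : ∀ᶠ s in 𝓝 t, γ s ∈ (chartAt H (γ t)).source :=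
    hγ.continuousAt ((chartAt H (γ t)).open_source.mem_nhds hp)
  have hy : HasDerivAt (fun s ↦ ((1 : ℝ), extChartAt I (γ t) (γ s)))
      (0, deriv (fun s ↦ extChartAt I (γ t) (γ s)) t) t :=
    (hasDerivAt_const t (1 : ℝ)).prodMk (hx.differentiableAt (by simp)).hasDerivAt
  have hD := hasFDerivAt_coneComponents g hpar (unitRadius, γ t)
  have hB : HasDerivAt (fun s ↦ (coneComponents V (unitRadius, γ t)
      ((1 : ℝ), extChartAt I (γ t) (γ s))).2)
      (fderiv ℝ (coneComponents V (unitRadius, γ t))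
        (extChartAt (coneModel I) ((unitRadius, γ t) : Cone M) (unitRadius, γ t))
        (0, deriv (fun s ↦ extChartAt I (γ t) (γ s)) t)).2 t := by
    have h0 : extChartAt (coneModel I) ((unitRadius, γ t) : Cone M) (unitRadius, γ t)
      = ((1 : ℝ), extChartAt I (γ t) (γ t)) := extChartAt_cone _ _
    rw [h0] at hD ⊢
    exact (HasFDerivAt.comp_hasDerivAt (l := coneComponents V (unitRadius, γ t)) t hD hy).snd
  have hW : HasDerivAt (fun s ↦ toChart I (γ t) (γ s) (tangentialPart V (γ s)))
      (fderiv ℝ (coneComponents V (unitRadius, γ t))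
        (extChartAt (coneModel I) ((unitRadius, γ t) : Cone M) (unitRadius, γ t))
        (0, deriv (fun s ↦ extChartAt I (γ t) (γ s)) t)).2 t := by
    refine hB.congr_of_eventuallyEq ?_
    filter_upwards [hsrc] with s hs
    have h1 : (extChartAt (coneModel I) ((unitRadius, γ t) : Cone M)).symm
        ((1 : ℝ), extChartAt I (γ t) (γ s)) = (unitRadius, γ s) := by
      rw [extChartAt_cone_symm]
      exact Prod.ext (extChartAt_posReals_symm unitRadius unitRadius)
        ((extChartAt I (γ t)).left_inv (by simpa using hs))
    rw [coneComponents, h1, toChart_cone _ (unitRadius, γ s) hs]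
    rfl
  refine (g.hasDerivAt_form_velocity hsm hacc hW).congr_deriv ?_
  have h := coneComponents_equation g hpar (unitRadius, γ t)
    (0, deriv (fun s ↦ extChartAt I (γ t) (γ s)) t)
    (0, deriv (fun s ↦ extChartAt I (γ t) (γ s)) t)
  have h1 : ((unitRadius : posReals) : ℝ) = 1 := rfl
  have h2 : ε * ε = 1 := by rcases hε with rfl | rfl <;> norm_num
  simp only [h1, one_pow, one_mul, mul_zero, zero_mul, zero_add, sub_zero] at h
  rw [g.form_eq_inChart hp, toChart_velocity hγ hp, radialComponent]
  rw [← mul_assoc, neg_mul, h2, neg_mul, neg_mul, one_mul]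
  unfold tangentialPart
  linarith

end RadialComponent

theorem mainTheorem8
    {E : Type*} [NormedAddCommGroup E] [NormedSpace ℝ E] [FiniteDimensional ℝ E]
    {H : Type*} [TopologicalSpace H] {I : ModelWithCorners ℝ E H} [I.Boundaryless]
    {M : Type*} [TopologicalSpace M] [ChartedSpace H M] [IsManifold I ∞ M] [T2Space M]
    (g : SemiRiemannianMetric I M) (ε : ℝ) (hε : ε = 1 ∨ ε = -1)
    (V : ∀ q : Cone M, TangentSpace (coneModel I) q)
    (hpar : (coneMetric g ε hε).IsParallel V)
    (hlight : ∀ q, (coneMetric g ε hε).IsLightLike q (V q)) :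
    ∃ u : M → ℝ,
      ContMDiff I 𝓘(ℝ, ℝ) ∞ u ∧
      (∀ q : Cone M, (coneMetric g ε hε).form q (V q) (radial I q) = u q.2) ∧
      (∀ (J : Set ℝ) (γ : ℝ → M), IsOpen J → J.OrdConnected → (0 : ℝ) ∈ J →
        g.IsGeodesicOn γ J →
        g.form (γ 0) (velocity I γ 0) (velocity I γ 0) = -ε →
        ContDiffOn ℝ ∞ (u ∘ γ) J ∧
        (∀ t ∈ J, iteratedDeriv 2 (u ∘ γ) t = (u ∘ γ) t) ∧
        (∀ t ∈ J, (u ∘ γ) t = u (γ 0) * Real.cosh t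
          + g.form (γ 0) (g.gradient u (γ 0)) (velocity I γ 0) * Real.sinh t)) ∧
      (g.IsComplete →
        ((∃ p, 0 < u p) → Ioi 0 ⊆ range u) ∧
        ((∃ p, u p < 0) → Iio 0 ⊆ range u)) := by
  have hu := contMDiff_radialComponent g hpar
  have hε2 : ε * ε = 1 := by rcases hε with rfl | rfl <;> norm_num
  have part1 : ∀ (J : Set ℝ) (γ : ℝ → M), IsOpen J → J.OrdConnected → (0 : ℝ) ∈ J →
      g.IsGeodesicOn γ J →
      g.form (γ 0) (velocity I γ 0) (velocity I γ 0) = -ε →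
      ContDiffOn ℝ ∞ (radialComponent ε V ∘ γ) J ∧
      (∀ t ∈ J, iteratedDeriv 2 (radialComponent ε V ∘ γ) t = (radialComponent ε V ∘ γ) t) ∧
      (∀ t ∈ J, (radialComponent ε V ∘ γ) t = radialComponent ε V (γ 0) * Real.cosh t
        + g.form (γ 0) (g.gradient (radialComponent ε V) (γ 0)) (velocity I γ 0)
          * Real.sinh t) := by
    intro J γ hJ hJc h0 hγ hspeed
    have hsm : ∀ t ∈ J, ContMDiffAt 𝓘(ℝ, ℝ) I ∞ γ t := fun t ht ↦
      hγ.1.contMDiffAt (hJ.mem_nhds ht)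
    have hd1 : ∀ t ∈ J, HasDerivAt (radialComponent ε V ∘ γ)
        (g.form (γ t) (tangentialPart V (γ t)) (velocity I γ t)) t := fun t ht ↦
      (hasDerivAt_comp_curve (hu (γ t)) (hsm t ht)).congr_deriv
        (mfderiv_radialComponent g hpar _ _)
    have hd2 : ∀ t ∈ J,
        HasDerivAt (fun t ↦ g.form (γ t) (tangentialPart V (γ t)) (velocity I γ t))
          ((radialComponent ε V ∘ γ) t) t := by
      intro t ht
      refine (hasDerivAt_form_tangentialPart_velocity g hpar
        (by filter_upwards [hJ.mem_nhds ht] with s hs using hsm s hs) (hγ.2 t ht)).congr_deriv ?_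
      rw [hγ.form_velocity_eq g hJ hJc ht h0, hspeed, Function.comp_apply]
      linear_combination radialComponent ε V (γ t) * hε2
    refine ⟨fun t ht ↦ ?_, fun t ht ↦ ?_, fun t ht ↦ ?_⟩
    · exact (contMDiffAt_iff_contDiffAt.1 ((hu (γ t)).comp t (hsm t ht))).contDiffWithinAt
    · have h : deriv (radialComponent ε V ∘ γ) =ᶠ[𝓝 t]
          fun t ↦ g.form (γ t) (tangentialPart V (γ t)) (velocity I γ t) := by
        filter_upwards [hJ.mem_nhds ht] with s hs using (hd1 s hs).deriv
      rw [iteratedDeriv_succ, iteratedDeriv_one, h.deriv_eq, (hd2 t ht).deriv]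
    · rw [gradient_radialComponent g hpar]
      exact eq_cosh_add_sinh_of_hasDerivAt hJ hJc h0 hd1 hd2 ht
  have part2 (hc : g.IsComplete) (p : M) (hp : radialComponent ε V p ≠ 0) (t : ℝ) :
      radialComponent ε V p * Real.exp t ∈ range (radialComponent ε V) := by
    obtain ⟨γ, hγ, hξ⟩ := hc ⟨p, (-ε * (radialComponent ε V p)⁻¹) • tangentialPart V p⟩
    have hγ0 : γ 0 = p := congrArg (fun ξ : TangentBundle I M ↦ ξ.1) hξ
    have hnull := form_tangentialPart g (hlight (unitRadius, p)).2
    have h1 := congrArg (fun ξ : TangentBundle I M ↦ g.form ξ.1 ξ.2 ξ.2) hξ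
    have h2 := congrArg (fun ξ : TangentBundle I M ↦
      g.form ξ.1 (g.gradient (radialComponent ε V) ξ.1) ξ.2) hξ
    simp only [map_smul, smul_apply, smul_eq_mul, gradient_radialComponent g hpar, hnull] at h1 h2
    have h3 := (part1 univ γ isOpen_univ ordConnected_univ (mem_univ 0) hγ
      (h1.trans ?_)).2.2 t (mem_univ t)
    · rw [gradient_radialComponent g hpar, h2, hγ0, Function.comp_apply] at h3
      refine ⟨γ t, h3.trans ?_⟩
      rw [← Real.cosh_add_sinh]
      field_simp
      linear_combination Real.sinh t * hε2
    · field_simp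
      linear_combination (-ε) * hε2
  refine ⟨radialComponent ε V, hu, fun q ↦ ?_, part1, fun hc ↦ ⟨?_, ?_⟩⟩
  · rw [form_coneMetric_radial]
    exact coneDr_eq_one g hpar q
  · rintro ⟨p, hp⟩ y hy
    have h := part2 hc p hp.ne' (Real.log (y / radialComponent ε V p))
    rwa [Real.exp_log (div_pos hy hp), mul_div_cancel₀ _ hp.ne'] at h
  · rintro ⟨p, hp⟩ y hy
    have h := part2 hc p hp.ne (Real.log (y / radialComponent ε V p))
    rwa [Real.exp_log (div_pos_of_neg_of_neg hy hp), mul_div_cancel₀ _ hp.ne] at h
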